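/- **Conventions.** Let $k$ be a field, $K$ its algebraic closure. A *C-diagram* in $\mathbb R^n$ is a finite union $\Gamma\subset\mathbb R^n_{\ge 0}$ of convex polytopes (not necessarily with lattice points as vertices) such that the region $\Gamma_+=\{t y : y\in\Gamma,\ t\ge 1\}$ on and above it is convex and central projection from the origin maps $\Gamma$ bijectively onto the unit simplex. A *face* of $\Gamma$ is a nonempty compact face of $\Gamma_+$; it is *inner* if it is not contained in any coordinate hyperplane. For $f=\sum a_m x^m\in k[[x_1,\dots,x_n]]$ and a face $\Delta$ put $f_\Delta=\sum_{m\in\Delta}a_mx^m$. The series $f$ is *inner non-degenerate* with respect to $\Gamma$ if $m\in\Gamma_+$ whenever $a_m\ne0$ (no monomial of $f$ lies below $\Gamma$), and for every inner face $\Delta$ and every common zero $Q=(q_1,\dots,q_n)\in K^n$ of $\frac{\partial f_\Delta}{\partial x_1},\dots,\frac{\partial f_\Delta}{\partial x_n}$ one has $\Delta\cap\{r\in\mathbb R^n : r_i=0 \text{ whenever } q_i=0\}=\emptyset$. A quadratic form $q$ over $k$ is *nondegenerate* if the bilinear form $q(u+v)-q(u)-q(v)$ is nondegenerate. Two power series $f(x)$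 and $g(y)$ over $k$ (in possibly different finite numbers of variables) are *stably equivalent* if there are nondegenerate quadratic forms $q(u)$, $r(v)$ in new variables (possibly none) such that an isomorphism of $k$-algebras $k[[x,u]]\to k[[y,v]]$ maps $f(x)+q(u)$ to $g(y)+r(v)$. **Proposition 2.1.** Let $k$ be a field of characteristic $p>0$. The series $x^p\in k[[x]]$ is not stably equivalent over $k$ to any power series $g\in k[[y_1,\dots,y_n]]$ ($n\ge 0$) that is inner non-degenerate with respect to some C-diagram in $\mathbb R^n$. -/

import Mathlib

noncomputable section

namespace StableNewton

/-! ### C-diagrams and their faces -/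

/-- The exponent vector `m`, viewed as a point of `ℝⁿ`. -/
def latticePoint {n : ℕ} (m : Fin n →₀ ℕ) : Fin n → ℝ := fun i => (m i : ℝ)

/-- The region `Γ₊` on and above `Γ`: all points `t • y` with `y ∈ Γ` and `t ≥ 1`. -/
def upperRegion {n : ℕ} (Γ : Set (Fin n → ℝ)) : Set (Fin n → ℝ) :=
  {x | ∃ y ∈ Γ, ∃ t : ℝ, 1 ≤ t ∧ x = t • y}

/-- A C-diagram in `ℝⁿ`: a finite union of convex polytopes in the nonnegative orthant such that
the region on and above it is convex and central projection from the origin onto the unit simplex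
is a bijection. The vertices are allowed to be arbitrary real points (in particular, they need
not be lattice points). -/
structure IsCDiagram {n : ℕ} (Γ : Set (Fin n → ℝ)) : Prop where
  polyhedral : ∃ S : Finset (Finset (Fin n → ℝ)),
    Γ = ⋃ s ∈ S, convexHull ℝ (s : Set (Fin n → ℝ))
  nonneg : ∀ x ∈ Γ, ∀ i, 0 ≤ x i
  convex_upperRegion : Convex ℝ (upperRegion Γ)
  bijOn_centralProjection :
    Set.BijOn (fun x : Fin n → ℝ => (∑ i, x i)⁻¹ • x) Γ (stdSimplex ℝ (Fin n))

/-- A face of the diagram `Γ`: a nonempty face of the polyhedron `Γ₊` (its intersection with a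
supporting hyperplane) that lies in `Γ`. For a C-diagram these are exactly the nonempty compact
faces of `Γ₊`. -/
structure IsFace {n : ℕ} (Γ Δ : Set (Fin n → ℝ)) : Prop where
  nonempty : Δ.Nonempty
  isExposed : IsExposed ℝ (upperRegion Γ) Δ
  subset : Δ ⊆ Γ

/-- An inner face: a face which is not contained in any coordinate hyperplane. -/
def IsInnerFace {n : ℕ} (Γ Δ : Set (Fin n → ℝ)) : Prop :=
  IsFace Γ Δ ∧ ∀ i : Fin n, ¬ Δ ⊆ {x | x i = 0}

/-! ### Inner non-degeneracy -/

/-- The polynomial `f_Δ = ∑_{m ∈ Δ} a_m x^m` for `f = ∑ a_m x^m`. It is only used for faces `Δ`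
of a C-diagram; these are bounded, so that the sum is finite. -/
def facePart {k : Type*} [Field k] {n : ℕ} (f : MvPowerSeries (Fin n) k)
    (Δ : Set (Fin n → ℝ)) : MvPolynomial (Fin n) k :=
  ∑ᶠ m ∈ {m : Fin n →₀ ℕ | latticePoint m ∈ Δ},
    MvPolynomial.monomial m (MvPowerSeries.coeff m f)

/-- The coordinate subspace `ℝ^I` with `I = {i | Q i ≠ 0}`. -/
def coordSubspace {K : Type*} [Field K] {n : ℕ} (Q : Fin n → K) : Set (Fin n → ℝ) :=
  {r | ∀ i, Q i = 0 → r i = 0}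

/-- `f` is inner non-degenerate with respect to the diagram `Γ`: no monomial of `f` lies
below `Γ`, and for every inner face `Δ` of `Γ` and every common zero `Q`, with coordinates in the
algebraic closure of `k`, of the partial derivatives of `f_Δ`, the face `Δ` does not meet the
coordinate subspace `ℝ^{I_Q}`, where `I_Q = {i | Q i ≠ 0}`. -/
structure IsInnerNonDegenerate {k : Type*} [Field k] {n : ℕ}
    (f : MvPowerSeries (Fin n) k) (Γ : Set (Fin n → ℝ)) : Prop where
  support_subset : ∀ m : Fin n →₀ ℕ, MvPowerSeries.coeff m f ≠ 0 →
    latticePoint m ∈ upperRegion Γ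
  inner : ∀ Δ : Set (Fin n → ℝ), IsInnerFace Γ Δ →
    ∀ Q : Fin n → AlgebraicClosure k,
      (∀ i, MvPolynomial.aeval Q (MvPolynomial.pderiv i (facePart f Δ)) = 0) →
        Δ ∩ coordSubspace Q = ∅

/-! ### Stable equivalence -/

/-- `q` is a nondegenerate quadratic form in `a` variables: a homogeneous polynomial of degree two
whose (constant) Hessian matrix, i.e. the Gram matrix of the associated bilinear form
`q(u + v) - q(u) - q(v)`, is invertible. -/
def IsNondegenerateQuadraticForm {k : Type*} [Field k] {a : ℕ}
    (q : MvPolynomial (Fin a) k) : Prop :=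
  q.IsHomogeneous 2 ∧
    (Matrix.of fun i j : Fin a =>
      MvPolynomial.coeff 0 (MvPolynomial.pderiv i (MvPolynomial.pderiv j q))).det ≠ 0

/-- The suspension `f(x) + q(u)` of `f` by the quadratic form `q` in new variables `u`. -/
def suspension {k : Type*} [Field k] {n a : ℕ} (f : MvPowerSeries (Fin n) k)
    (q : MvPolynomial (Fin a) k) : MvPowerSeries (Fin n ⊕ Fin a) k :=
  MvPowerSeries.rename Sum.inl f +
    ((MvPolynomial.rename Sum.inr q : MvPolynomial (Fin n ⊕ Fin a) k) :
      MvPowerSeries (Fin n ⊕ Fin a) k)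

/-- Right equivalence: an isomorphism of `k`-algebras between the power series rings (a formal
change of coordinates) carries `f` to `g`. -/
def RightEquivalent {k : Type*} [Field k] {σ τ : Type*}
    (f : MvPowerSeries σ k) (g : MvPowerSeries τ k) : Prop :=
  ∃ φ : MvPowerSeries σ k ≃ₐ[k] MvPowerSeries τ k, φ f = g

/-- Stable equivalence: right equivalence after adding nondegenerate quadratic forms in new
variables to both series. -/
def StablyEquivalent {k : Type*} [Field k] {n m : ℕ}
    (f : MvPowerSeries (Fin n) k) (g : MvPowerSeries (Fin m) k) : Prop :=
  ∃ (a b : ℕ) (q : MvPolynomial (Fin a) k) (r : MvPolynomial (Fin b) k),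
    IsNondegenerateQuadraticForm q ∧ IsNondegenerateQuadraticForm r ∧
      RightEquivalent (suspension f q) (suspension g r)

end StableNewton

end

noncomputable section

namespace StableNewton

open MvPowerSeries (pderiv rename)

/-! ### Formal curves and the critical curve of a suspension -/

section PowerSeriesRings

variable {k : Type*} [Field k]

/-! In characteristic $p$ the critical locus of $x^p+q(u)$ contains the smooth curve $u=0$. A stable
equivalence carries it to a formal curve in the critical locus of $g(y)+r(v)$. Nondegeneracy of $r$
forces $v=0$ along it, so a nonconstant formal curve $c$ lies in the critical locus of $g$
(`exists_curve_of_stablyEquivalent`).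

Inner non-degeneracy forbids such a curve (`IsInnerNonDegenerate.exists_map_pderiv_ne_zero`). The
orders of the coordinates of $c$ are the obvious weights, but they may be infinite or select a face
that is not inner. `exists_weight` replaces them by smaller positive weights $w$ whose minimal face
$\Delta$ is inner and still meets the coordinate subspace of the indices where $w_i$ is the order.
Let $d$ be the minimum of $w$ on $\Gamma$. The coefficient of $t^{d-w_i}$ in $c(\partial_i g)=0$
shows that the coefficients $Q_i$ of $t^{w_i}$ in the coordinates of $c$ form a common zero of the
partials of $g_\Delta$ (`aeval_pderiv_initialForm_eq_zero`). Since $Q_i\ne0$ exactly at those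
indices, $\Delta$ meets the subspace attached to $Q$, a contradiction. -/

theorem exists_eq_sum_X_mul {σ : Type*} [Fintype σ] (h : MvPowerSeries σ k)
    (h0 : MvPowerSeries.coeff 0 h = 0) :
    ∃ h' : σ → MvPowerSeries σ k, h = ∑ s, MvPowerSeries.X s * h' s ∧
      ∀ s m, MvPowerSeries.coeff m (h' s) = MvPowerSeries.coeff (m + Finsupp.single s 1) h ∨
        MvPowerSeries.coeff m (h' s) = 0 := by
  classical
  rcases isEmpty_or_nonempty σ with hσ | hσ
  · refine ⟨fun _ => 0, ?_, fun s => hσ.elim s⟩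
    ext m
    rw [Subsingleton.elim m 0, h0]
    simp
  have hidx : ∀ m : σ →₀ ℕ, ∃ s, m ≠ 0 → m s ≠ 0 := fun m => by
    by_cases hm : m = 0
    · exact ⟨Classical.arbitrary σ, fun h => (h hm).elim⟩
    · obtain ⟨s, hs⟩ := Finsupp.ne_iff.mp hm
      exact ⟨s, fun _ => by simpa using hs⟩
  choose idx hidx using hidx
  -- Each nonconstant monomial of `h` is charged to a single variable dividing it, so nothing is
  -- counted twice.
  let h' : σ → MvPowerSeries σ k := fun s m =>
    if idx (m + Finsupp.single s 1) = s then
      MvPowerSeries.coeff (m + Finsupp.single s 1) h else 0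
  have hh' : ∀ s m, MvPowerSeries.coeff m (h' s) =
    if idx (m + Finsupp.single s 1) = s then
      MvPowerSeries.coeff (m + Finsupp.single s 1) h else 0 := fun _ _ => rfl
  refine ⟨h', ?_, fun s m => ?_⟩
  · ext m
    simp only [map_sum, MvPowerSeries.X, MvPowerSeries.coeff_monomial_mul, one_mul]
    by_cases hm : m = 0
    · subst hm
      rw [h0, Finset.sum_eq_zero]
      intro s _
      rw [if_neg]
      intro hs
      simpa using hs s
    · rw [Finset.sum_eq_single (idx m)]
      · have hle : Finsupp.single (idx m) 1 ≤ m := by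
          rw [Finsupp.single_le_iff]
          exact Nat.one_le_iff_ne_zero.mpr (hidx m hm)
        rw [if_pos hle, hh', tsub_add_cancel_of_le hle, if_pos rfl]
      · intro s _ hs
        split_ifs with hle
        · rw [hh', tsub_add_cancel_of_le hle, if_neg hs.symm]
        · rfl
      · simp
  · rw [hh']
    split_ifs
    · exact Or.inl rfl
    · exact Or.inr rfl

/-- Continuity of `c` is not assumed. This substitutes for it and allows a series to be truncated
before `c` is applied. -/
theorem X_pow_dvd_map_of_coeff_eq_zero {σ : Type*} [Fintype σ]
    (c : MvPowerSeries σ k →ₐ[k] PowerSeries k)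
    (hc : ∀ s, PowerSeries.X ∣ c (MvPowerSeries.X s)) (N : ℕ) :
    ∀ h : MvPowerSeries σ k, (∀ m : σ →₀ ℕ, m.degree < N → MvPowerSeries.coeff m h = 0) →
      PowerSeries.X ^ N ∣ c h := by
  induction N with
  | zero => intro h _; simp
  | succ N ih =>
    intro h hh
    obtain ⟨h', rfl, hh'⟩ := exists_eq_sum_X_mul h (hh 0 (by simp))
    rw [map_sum]
    refine Finset.dvd_sum fun s _ => ?_
    rw [map_mul, pow_succ']
    refine mul_dvd_mul (hc s) (ih _ fun m hm => ?_)
    rcases hh' s m with h1 | h1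
    · rw [h1]
      refine hh _ ?_
      rw [map_add, Finsupp.degree_single]
      omega
    · exact h1

theorem map_C_eq {σ : Type*} (c : MvPowerSeries σ k →ₐ[k] PowerSeries k) (a : k) :
    c (MvPowerSeries.C a) = PowerSeries.C a :=
  c.commutes a

/-- If the image had constant term $a\ne0$, then $X_s-a$ would be a unit with a non-unit image. -/
theorem X_dvd_map_X {σ : Type*} (c : MvPowerSeries σ k →ₐ[k] PowerSeries k) (s : σ) :
    PowerSeries.X ∣ c (MvPowerSeries.X s) := by
  rw [PowerSeries.X_dvd_iff]
  by_contra hne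
  set a := PowerSeries.constantCoeff (c (MvPowerSeries.X s))
  have hu : IsUnit (MvPowerSeries.X s - MvPowerSeries.C a : MvPowerSeries σ k) := by
    rw [MvPowerSeries.isUnit_iff_constantCoeff]
    simpa using hne
  have := PowerSeries.isUnit_constantCoeff _ (hu.map c)
  rw [map_sub, map_C_eq] at this
  simp [a] at this

/-- Otherwise `c` kills the maximal ideal and its image consists of constants. -/
theorem exists_map_X_ne_zero {σ : Type*} [Fintype σ]
    (c : MvPowerSeries σ k →ₐ[k] PowerSeries k) (hc : Function.Surjective c) :
    ∃ s, c (MvPowerSeries.X s) ≠ 0 := by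
  by_contra! hs
  obtain ⟨h, hh⟩ := hc PowerSeries.X
  obtain ⟨h', he, -⟩ := exists_eq_sum_X_mul
    (h - MvPowerSeries.C (MvPowerSeries.coeff 0 h)) (by simp)
  have : c (h - MvPowerSeries.C (MvPowerSeries.coeff 0 h)) = 0 := by
    rw [he, map_sum]
    exact Finset.sum_eq_zero fun s _ => by rw [map_mul, hs, zero_mul]
  rw [map_sub, hh, map_C_eq] at this
  have := congrArg (PowerSeries.coeff 1) this
  simp at this

theorem map_coe_eq_aeval {σ : Type*} {A : Type*} [CommRing A] [Algebra k A]
    (c : MvPowerSeries σ k →ₐ[k] A) (P : MvPolynomial σ k) :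
    c (P : MvPowerSeries σ k) = MvPolynomial.aeval (fun s => c (MvPowerSeries.X s)) P := by
  have : c.comp (MvPolynomial.coeToMvPowerSeries.algHom k) =
      MvPolynomial.aeval (fun s => c (MvPowerSeries.X s)) := by
    ext s
    simp
  have := DFunLike.congr_fun this P
  simpa using this

theorem map_coe_rename_eq_aeval {σ τ : Type*} {A : Type*} [CommRing A] [Algebra k A]
    (c : MvPowerSeries τ k →ₐ[k] A) (f : σ → τ) (P : MvPolynomial σ k) :
    c ((MvPolynomial.rename f P : MvPolynomial τ k) : MvPowerSeries τ k) =
      MvPolynomial.aeval (fun s => c (MvPowerSeries.X (f s))) P := by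
  rw [map_coe_eq_aeval, MvPolynomial.aeval_rename]
  rfl

theorem pderiv_rename_of_injective {σ τ : Type*} (f : σ → τ) [Filter.TendstoCofinite f]
    (hf : Function.Injective f) (i : σ) (h : MvPowerSeries σ k) :
    pderiv k (f i) (rename f h) = rename f (pderiv k i h) := by
  obtain ⟨e, rfl⟩ : ∃ e : σ ↪ τ, ⇑e = f := ⟨⟨f, hf⟩, rfl⟩
  ext x
  rw [MvPowerSeries.coeff_pderiv]
  by_cases hx : x ∈ Set.range (Finsupp.embDomain (M := ℕ) e)
  · obtain ⟨y, rfl⟩ := hx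
    rw [MvPowerSeries.coeff_embDomain_rename, MvPowerSeries.coeff_pderiv,
      Finsupp.embDomain_apply_self, ← Finsupp.embDomain_single, ← Finsupp.embDomain_add,
      MvPowerSeries.coeff_embDomain_rename]
  · have hx' : x + Finsupp.single (e i) 1 ∉ Set.range (Finsupp.embDomain (M := ℕ) e) := by
      intro h1
      apply hx
      rw [Finsupp.mem_range_embDomain_iff] at h1 ⊢
      refine fun t ht => h1 ?_
      simp only [Finset.mem_coe, Finsupp.mem_support_iff, Finsupp.add_apply] at ht ⊢
      omega
    have hr : Set.range (Finsupp.embDomain (M := ℕ) e) = Set.range (Finsupp.mapDomain e) := by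
      congr 1
      ext1 y
      exact Finsupp.embDomain_eq_mapDomain e y
    rw [hr] at hx hx'
    rw [MvPowerSeries.coeff_rename_eq_zero _ _ hx', MvPowerSeries.coeff_rename_eq_zero _ _ hx,
      zero_mul]

theorem pderiv_rename_of_notMem_range {σ τ : Type*} (f : σ → τ) [Filter.TendstoCofinite f]
    (t : τ) (ht : t ∉ Set.range f) (h : MvPowerSeries σ k) :
    pderiv k t (rename f h) = 0 := by
  ext x
  rw [MvPowerSeries.coeff_pderiv, MvPowerSeries.coeff_rename_eq_zero]
  · simp
  · rintro ⟨y, hy⟩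
    have h1 := Finsupp.mapDomain_of_notMem_range y t ht
    rw [hy] at h1
    simp at h1

theorem derivation_aeval_eq_sum {σ A : Type*} [Fintype σ] [CommRing A] [Algebra k A]
    (D : Derivation k A A) (z : σ → A) (P : MvPolynomial σ k) :
    D (MvPolynomial.aeval z P) =
      ∑ i, MvPolynomial.aeval z (MvPolynomial.pderiv i P) * D (z i) := by
  classical
  induction P using MvPolynomial.induction_on with
  | C a => simp
  | add p q hp hq => simp [hp, hq, add_mul, Finset.sum_add_distrib]
  | mul_X p s hp =>
    simp only [map_mul, MvPolynomial.aeval_X, Derivation.leibniz, hp, smul_eq_mul, map_add,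
      add_mul, Finset.sum_add_distrib, MvPolynomial.pderiv_X, Pi.single_apply]
    simp [apply_ite (MvPolynomial.aeval z), Finset.mul_sum, mul_assoc]

/-- Euler's identity is applied to the linear form $\partial_j q$, where its factor is 1, so
characteristic 2 needs no separate treatment. -/
theorem aeval_pderiv_eq_sum {a : ℕ} {A : Type*} [CommRing A] [Algebra k A]
    {q : MvPolynomial (Fin a) k} (hq : q.IsHomogeneous 2) (z : Fin a → A) (j : Fin a) :
    MvPolynomial.aeval z (MvPolynomial.pderiv j q) =
      ∑ i, z i * algebraMap k A
        (MvPolynomial.coeff 0 (MvPolynomial.pderiv i (MvPolynomial.pderiv j q))) := by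
  have h1 : (MvPolynomial.pderiv j q).IsHomogeneous 1 := hq.pderiv
  have h2 := h1.sum_X_mul_pderiv
  rw [one_smul] at h2
  conv_lhs => rw [← h2]
  rw [map_sum]
  refine Finset.sum_congr rfl fun i _ => ?_
  have h3 : (MvPolynomial.pderiv i (MvPolynomial.pderiv j q)).IsHomogeneous 0 := h1.pderiv
  rw [← MvPolynomial.totalDegree_zero_iff_isHomogeneous,
    MvPolynomial.totalDegree_eq_zero_iff_eq_C] at h3
  conv_lhs => rw [h3]
  simp

theorem eq_zero_of_aeval_pderiv_eq_zero {a : ℕ} {A : Type*} [CommRing A] [IsDomain A]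
    [Algebra k A] {q : MvPolynomial (Fin a) k} (hq : IsNondegenerateQuadraticForm q)
    (z : Fin a → A) (hz : ∀ j, MvPolynomial.aeval z (MvPolynomial.pderiv j q) = 0) : z = 0 := by
  obtain ⟨hq2, hdet⟩ := hq
  refine Matrix.eq_zero_of_vecMul_eq_zero (M := (algebraMap k A).mapMatrix (Matrix.of
    fun i j : Fin a => MvPolynomial.coeff 0 (MvPolynomial.pderiv i (MvPolynomial.pderiv j q))))
    ?_ ?_
  · rw [← RingHom.map_det]
    simpa using hdet
  · ext j
    rw [Pi.zero_apply, ← hz j, aeval_pderiv_eq_sum hq2]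
    rfl

/-- The critical curve of a series stably equivalent to `x ^ p`. -/
theorem exists_curve_of_stablyEquivalent (p : ℕ) [CharP k p] {n : ℕ}
    (g : MvPowerSeries (Fin n) k)
    (hst : StablyEquivalent ((MvPowerSeries.X 0 : MvPowerSeries (Fin 1) k) ^ p) g) :
    ∃ c : MvPowerSeries (Fin n) k →ₐ[k] PowerSeries k,
      (∃ i, c (MvPowerSeries.X i) ≠ 0) ∧ ∀ i, c (pderiv k i g) = 0 := by
  obtain ⟨a, b, q, r, hq, hr, φ, hφ⟩ := hst
  let inl : Fin 1 ↪ Fin 1 ⊕ Fin a := Function.Embedding.inl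
  -- Restriction to the curve $u=0$; `c` below is its transport through `φ`.
  let π : MvPowerSeries (Fin 1 ⊕ Fin a) k →ₐ[k] PowerSeries k :=
    (MvPowerSeries.renameEquiv k (Equiv.ofUnique (Fin 1) Unit)).toAlgHom.comp
      (MvPowerSeries.killCompl inl)
  have hπ : Function.Surjective π :=
    (MvPowerSeries.renameEquiv k (Equiv.ofUnique (Fin 1) Unit)).surjective.comp
      fun h => ⟨rename inl h, MvPowerSeries.killCompl_rename_app h⟩
  have hπr : ∀ j, π (MvPowerSeries.X (Sum.inr j)) = 0 := fun j => by
    have : MvPowerSeries.killCompl (R := k) inl (MvPowerSeries.X (Sum.inr j)) = 0 :=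
      MvPowerSeries.killCompl_X_eq_zero (by rintro ⟨x, hx⟩; cases hx)
    simp only [π, AlgHom.comp_apply, this, map_zero]
  let c : MvPowerSeries (Fin n ⊕ Fin b) k →ₐ[k] PowerSeries k := π.comp φ.symm.toAlgHom
  have hc : Function.Surjective c := hπ.comp φ.symm.surjective
  have hcφ : ∀ h, c (φ h) = π h := fun h => congrArg π (φ.symm_apply_apply h)
  have hcrit : ∀ t, c (pderiv k t (suspension g r)) = 0 := by
    intro t
    -- The derivative of $\varphi(x)^p$ vanishes in characteristic $p$. The chain rule is needed
    -- only for the polynomial $q$, whose partials at $\varphi(u)$ are linear in the $\varphi(u_j)$,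
    -- and `c` kills these.
    rw [← hφ, suspension, map_add, map_add, map_pow, map_pow, map_add, Derivation.leibniz_pow,
      show φ ((MvPolynomial.rename Sum.inr q : MvPolynomial (Fin 1 ⊕ Fin a) k) :
        MvPowerSeries (Fin 1 ⊕ Fin a) k) = _ from
        map_coe_rename_eq_aeval φ.toAlgHom Sum.inr q, derivation_aeval_eq_sum]
    have hp0 : (p : MvPowerSeries (Fin n ⊕ Fin b) k) = 0 := by
      rw [← map_natCast (algebraMap k (MvPowerSeries (Fin n ⊕ Fin b) k)), CharP.cast_eq_zero,
        map_zero]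
    rw [nsmul_eq_mul, hp0, zero_mul, map_zero, zero_add, map_sum]
    refine Finset.sum_eq_zero fun i _ => ?_
    rw [map_mul, aeval_pderiv_eq_sum hq.1, map_sum, Finset.sum_eq_zero, zero_mul]
    intro j _
    rw [map_mul, show c (φ.toAlgHom (MvPowerSeries.X (Sum.inr j))) = _ from hcφ _, hπr, zero_mul]
  have hinr : (fun j => c (MvPowerSeries.X (Sum.inr j))) = 0 := by
    refine eq_zero_of_aeval_pderiv_eq_zero hr _ fun j => ?_
    rw [← map_coe_rename_eq_aeval, ← MvPowerSeries.rename_coe,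
      ← MvPowerSeries.pderiv_coe, ← pderiv_rename_of_injective _ Sum.inr_injective]
    have h1 := hcrit (Sum.inr j)
    rw [suspension, map_add, pderiv_rename_of_notMem_range Sum.inl _ (by simp), zero_add,
      ← MvPowerSeries.rename_coe] at h1
    exact h1
  refine ⟨c.comp (rename Sum.inl), ?_, fun i => ?_⟩
  · obtain ⟨s | s, hs⟩ := exists_map_X_ne_zero c hc
    · exact ⟨s, by simpa using hs⟩
    · exact (hs (congrFun hinr s)).elim
  · have h1 := hcrit (Sum.inl i)
    rw [suspension, map_add, pderiv_rename_of_injective _ Sum.inl_injective,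
      ← MvPowerSeries.rename_coe, pderiv_rename_of_notMem_range Sum.inr _ (by simp), add_zero] at h1
    exact h1

end PowerSeriesRings

/-! ### Initial coefficients with respect to real weights -/

section InitialTerms

variable {k : Type*} [Field k]

/-- The series `s` has order at least `w`, and `a` is its coefficient at the real exponent `w`. -/
structure HasInitialCoeff (s : PowerSeries k) (w : ℝ) (a : k) : Prop where
  coeff_of_lt : ∀ N : ℕ, (N : ℝ) < w → PowerSeries.coeff N s = 0
  coeff_of_eq : ∀ N : ℕ, (N : ℝ) = w → PowerSeries.coeff N s = a
  exists_nat : a ≠ 0 → ∃ N : ℕ, (N : ℝ) = w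

theorem HasInitialCoeff.one : HasInitialCoeff (1 : PowerSeries k) 0 1 where
  coeff_of_lt N hN := absurd hN (not_lt.mpr N.cast_nonneg)
  coeff_of_eq N hN := by
    rw [Nat.cast_eq_zero] at hN
    simp [hN]
  exists_nat _ := ⟨0, Nat.cast_zero⟩

theorem HasInitialCoeff.mul {s t : PowerSeries k} {v w : ℝ} {a b : k}
    (hs : HasInitialCoeff s v a) (ht : HasInitialCoeff t w b) :
    HasInitialCoeff (s * t) (v + w) (a * b) where
  coeff_of_lt N hN := by
    rw [PowerSeries.coeff_mul]
    refine Finset.sum_eq_zero fun x hx => ?_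
    rw [Finset.HasAntidiagonal.mem_antidiagonal] at hx
    rw [← hx, Nat.cast_add] at hN
    rcases lt_or_ge (x.1 : ℝ) v with h | h
    · rw [hs.coeff_of_lt _ h, zero_mul]
    · rw [ht.coeff_of_lt _ (by linarith), mul_zero]
  coeff_of_eq N hN := by
    rw [PowerSeries.coeff_mul]
    have key : ∀ x ∈ Finset.HasAntidiagonal.antidiagonal N,
        PowerSeries.coeff x.1 s * PowerSeries.coeff x.2 t ≠ 0 → (x.1 : ℝ) = v ∧ (x.2 : ℝ) = w := by
      intro x hx hne
      rw [Finset.HasAntidiagonal.mem_antidiagonal] at hx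
      rw [← hx, Nat.cast_add] at hN
      have h1 : v ≤ x.1 := not_lt.mp fun h => hne (by rw [hs.coeff_of_lt _ h, zero_mul])
      have h2 : w ≤ x.2 := not_lt.mp fun h => hne (by rw [ht.coeff_of_lt _ h, mul_zero])
      constructor <;> linarith
    by_cases hab : ∃ i j : ℕ, (i : ℝ) = v ∧ (j : ℝ) = w
    · obtain ⟨i, j, hi, hj⟩ := hab
      rw [Finset.sum_eq_single (i, j), hs.coeff_of_eq i hi, ht.coeff_of_eq j hj]
      · intro x hx hxne
        by_contra hne
        obtain ⟨h1, h2⟩ := key x hx hne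
        rw [← hi, Nat.cast_inj] at h1
        rw [← hj, Nat.cast_inj] at h2
        exact hxne (Prod.ext h1 h2)
      · intro hij
        refine absurd ?_ hij
        rw [Finset.HasAntidiagonal.mem_antidiagonal]
        rw [← hi, ← hj] at hN
        exact_mod_cast hN.symm
    · have : a * b = 0 := by
        by_contra hne
        obtain ⟨i, hi⟩ := hs.exists_nat (left_ne_zero_of_mul hne)
        obtain ⟨j, hj⟩ := ht.exists_nat (right_ne_zero_of_mul hne)
        exact hab ⟨i, j, hi, hj⟩
      rw [this]
      refine Finset.sum_eq_zero fun x hx => ?_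
      by_contra hne
      exact hab ⟨x.1, x.2, key x hx hne⟩
  exists_nat h := by
    obtain ⟨i, hi⟩ := hs.exists_nat (left_ne_zero_of_mul h)
    obtain ⟨j, hj⟩ := ht.exists_nat (right_ne_zero_of_mul h)
    exact ⟨i + j, by rw [Nat.cast_add, hi, hj]⟩

theorem HasInitialCoeff.pow {s : PowerSeries k} {w : ℝ} {a : k} (hs : HasInitialCoeff s w a)
    (m : ℕ) : HasInitialCoeff (s ^ m) (w * m) (a ^ m) := by
  induction m with
  | zero => simpa using HasInitialCoeff.one
  | succ m ih =>
    rw [pow_succ, pow_succ, Nat.cast_succ, mul_add, mul_one]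
    exact ih.mul hs

theorem HasInitialCoeff.prod {ι : Type*} (A : Finset ι) {s : ι → PowerSeries k} {w : ι → ℝ}
    {a : ι → k} (hs : ∀ i, HasInitialCoeff (s i) (w i) (a i)) :
    HasInitialCoeff (∏ i ∈ A, s i) (∑ i ∈ A, w i) (∏ i ∈ A, a i) := by
  classical
  induction A using Finset.induction_on with
  | empty => simpa using HasInitialCoeff.one
  | insert i A hi ih =>
    rw [Finset.prod_insert hi, Finset.prod_insert hi, Finset.sum_insert hi]
    exact (hs i).mul ih

theorem aeval_pderiv_sum_monomial {n : ℕ} {A : Type*} [CommRing A] [Algebra k A]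
    (g : MvPowerSeries (Fin n) k) (F : Finset (Fin n →₀ ℕ)) (z : Fin n → A) (i : Fin n) :
    MvPolynomial.aeval z (MvPolynomial.pderiv i
        (∑ m ∈ F, MvPolynomial.monomial m (MvPowerSeries.coeff m g))) =
      ∑ m ∈ F, algebraMap k A (MvPowerSeries.coeff m g * m i) *
        ∏ j, z j ^ (m - Finsupp.single i 1 : Fin n →₀ ℕ) j := by
  rw [map_sum, map_sum]
  refine Finset.sum_congr rfl fun m _ => ?_
  rw [MvPolynomial.pderiv_monomial, MvPolynomial.aeval_monomial, Finsupp.prod_fintype]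
  simp

theorem dotProduct_latticePoint_sub_single {n : ℕ} (w : Fin n → ℝ) {m : Fin n →₀ ℕ} {i : Fin n}
    (hi : m i ≠ 0) :
    ∑ j, w j * (((m - Finsupp.single i 1 : Fin n →₀ ℕ) j : ℕ) : ℝ) = w ⬝ᵥ latticePoint m - w i := by
  classical
  have hle : Finsupp.single i 1 ≤ m := by
    rw [Finsupp.single_le_iff]
    exact Nat.one_le_iff_ne_zero.mpr hi
  have : w ⬝ᵥ latticePoint m =
      ∑ j, w j * (((m - Finsupp.single i 1 + Finsupp.single i 1 : Fin n →₀ ℕ) j : ℕ) : ℝ) := by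
    rw [tsub_add_cancel_of_le hle]
    rfl
  rw [this]
  simp [-Finsupp.coe_tsub, mul_add, Finset.sum_add_distrib, Finsupp.single_apply]

/-- Along the curve, a monomial of weight $e$ contributes to $\partial_i g$ only from order $e-w_i$
on. Hence only the monomials of minimal weight $d$ reach the coefficient at $d-w_i$. -/
theorem aeval_pderiv_initialForm_eq_zero {n : ℕ} (g : MvPowerSeries (Fin n) k)
    (c : MvPowerSeries (Fin n) k →ₐ[k] PowerSeries k) {w : Fin n → ℝ} {Q : Fin n → k}
    (hw : ∀ i, HasInitialCoeff (c (MvPowerSeries.X i)) (w i) (Q i)) {d : ℝ}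
    (hd : ∀ m, MvPowerSeries.coeff m g ≠ 0 → d ≤ w ⬝ᵥ latticePoint m)
    (F : Finset (Fin n →₀ ℕ)) (hF : ∀ m ∈ F, w ⬝ᵥ latticePoint m = d)
    (hF' : ∀ m, w ⬝ᵥ latticePoint m = d → MvPowerSeries.coeff m g ≠ 0 → m ∈ F) (i : Fin n)
    (hi : c (pderiv k i g) = 0) :
    MvPolynomial.aeval Q (MvPolynomial.pderiv i
      (∑ m ∈ F, MvPolynomial.monomial m (MvPowerSeries.coeff m g))) = 0 := by
  classical
  have hmon : ∀ m : Fin n →₀ ℕ, m i ≠ 0 →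
      HasInitialCoeff (∏ j, c (MvPowerSeries.X j) ^ (m - Finsupp.single i 1 : Fin n →₀ ℕ) j)
        (w ⬝ᵥ latticePoint m - w i) (∏ j, Q j ^ (m - Finsupp.single i 1 : Fin n →₀ ℕ) j) := by
    intro m hm
    rw [← dotProduct_latticePoint_sub_single w hm]
    exact HasInitialCoeff.prod _ fun j => (hw j).pow _
  rw [aeval_pderiv_sum_monomial]
  by_cases hN : ∃ N : ℕ, (N : ℝ) = d - w i
  · obtain ⟨N, hN⟩ := hN
    have hfin := Finsupp.finite_of_degree_le (σ := Fin n) (N + 1)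
    -- Differentiation lowers the degree by one, so agreement up to degree `N + 1` is what makes the
    -- remainder invisible at order `N`.
    let T := F ∪ hfin.toFinset
    let P := MvPowerSeries.truncFinset k T g
    have hrest : PowerSeries.X ^ (N + 1) ∣
        c (pderiv k i (g - (P : MvPowerSeries (Fin n) k))) := by
      refine X_pow_dvd_map_of_coeff_eq_zero c (X_dvd_map_X c) _ _ fun m hm => ?_
      have hmT : m + Finsupp.single i 1 ∈ T := by
        refine Finset.mem_union_right _ ?_
        rw [Set.Finite.mem_toFinset, Set.mem_ofPred_eq, map_add, Finsupp.degree_single]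
        omega
      rw [MvPowerSeries.coeff_pderiv, map_sub, MvPolynomial.coeff_coe,
        MvPowerSeries.coeff_truncFinset_of_mem _ hmT, sub_self, zero_mul]
    have h0 : PowerSeries.coeff N (c (pderiv k i (P : MvPowerSeries (Fin n) k))) = 0 := by
      rw [map_sub, map_sub, hi, zero_sub, dvd_neg, PowerSeries.X_pow_dvd_iff] at hrest
      exact hrest N (Nat.lt_succ_self N)
    rw [MvPowerSeries.pderiv_coe, map_coe_eq_aeval,
      show P = _ from MvPowerSeries.truncFinset_apply g,
      aeval_pderiv_sum_monomial, map_sum] at h0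
    rw [← h0, ← Finset.sum_subset (Finset.subset_union_left : F ⊆ T)]
    · refine Finset.sum_congr rfl fun m hm => ?_
      rw [show algebraMap k (PowerSeries k) (MvPowerSeries.coeff m g * m i) =
        PowerSeries.C (MvPowerSeries.coeff m g * m i) from rfl, PowerSeries.coeff_C_mul]
      by_cases hmi : m i = 0
      · simp [hmi]
      · rw [(hmon m hmi).coeff_of_eq N (by rw [hN, hF m hm])]
        rfl
    · intro m _ hm
      rw [show algebraMap k (PowerSeries k) (MvPowerSeries.coeff m g * m i) =
        PowerSeries.C (MvPowerSeries.coeff m g * m i) from rfl, PowerSeries.coeff_C_mul]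
      by_cases hmi : m i = 0
      · simp [hmi]
      by_cases hmg : MvPowerSeries.coeff m g = 0
      · simp [hmg]
      have hlt : d < w ⬝ᵥ latticePoint m :=
        lt_of_le_of_ne (hd m hmg) fun h => hm (hF' m h.symm hmg)
      rw [(hmon m hmi).coeff_of_lt N (by rw [hN]; linarith), mul_zero]
  -- If $d-w_i$ is not a natural number, no such coefficient exists, but then every summand already
  -- vanishes by `exists_nat`.
  · refine Finset.sum_eq_zero fun m hm => ?_
    by_cases hmi : m i = 0
    · simp [hmi]
    · have := (hmon m hmi).exists_nat
      rw [hF m hm] at this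
      rw [not_imp_comm.mp this hN, mul_zero]

end InitialTerms

/-! ### Choice of the weight vector -/

section Weights

open Filter Topology

/-- Lowering weights as far as possible, keeping a lower bound on a finite set of points. -/
theorem exists_minimal_weight {n : ℕ} (V : Finset (Fin n → ℝ))
    (hV : ∀ v ∈ V, ∀ i, 0 ≤ v i) (haxis : ∀ i, ∃ v ∈ V, 0 < v i ∧ ∀ j, j ≠ i → v j = 0)
    {d : ℝ} (hd : 0 < d) (u : Fin n → ℝ) (hu0 : ∀ i, 0 ≤ u i) (hu : ∀ v ∈ V, d ≤ u ⬝ᵥ v) :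
    ∃ w : Fin n → ℝ, (∀ i, 0 < w i) ∧ (∀ i, w i ≤ u i) ∧ (∀ v ∈ V, d ≤ w ⬝ᵥ v) ∧
      ∀ i, ∃ v ∈ V, w ⬝ᵥ v = d ∧ 0 < v i := by
  classical
  let W : Set (Fin n → ℝ) := Set.Icc 0 u ∩ ⋂ v ∈ V, {w | d ≤ w ⬝ᵥ v}
  have hW : IsCompact W := by
    refine isCompact_Icc.inter_right (isClosed_biInter fun v _ => ?_)
    exact isClosed_le continuous_const (by unfold dotProduct; fun_prop)
  have hmem : ∀ w, w ∈ W ↔ (∀ i, 0 ≤ w i) ∧ (∀ i, w i ≤ u i) ∧ ∀ v ∈ V, d ≤ w ⬝ᵥ v := by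
    intro w
    simp only [W, Set.mem_inter_iff, Set.mem_Icc, Pi.le_def, Pi.zero_apply, Set.mem_iInter,
      Set.mem_ofPred_eq, and_assoc]
  -- Minimality of the coordinate sum means that no single weight can be lowered further.
  obtain ⟨w, hwW, hmin⟩ := hW.exists_isMinOn ⟨u, (hmem u).mpr ⟨hu0, fun _ => le_rfl, hu⟩⟩
    (f := fun w => ∑ i, w i) (by fun_prop)
  obtain ⟨hw0, hwu, hwV⟩ := (hmem w).mp hwW
  have hpos : ∀ i, 0 < w i := by
    intro i
    obtain ⟨v, hv, hvi, hvj⟩ := haxis i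
    have h1 : w ⬝ᵥ v = w i * v i := by
      rw [dotProduct, Finset.sum_eq_single i (fun j _ hj => by rw [hvj j hj, mul_zero]) (by simp)]
    have h2 := hwV v hv
    rw [h1] at h2
    exact pos_of_mul_pos_left (hd.trans_le h2) hvi.le
  refine ⟨w, hpos, hwu, hwV, fun i => ?_⟩
  by_contra! hno
  -- If all tight points have zero $i$-th coordinate, a small decrease of $w_i$ leaves them tight
  -- and keeps the other, strict inequalities.
  have hev : ∀ᶠ ε in 𝓝[>] (0 : ℝ), w - ε • Pi.single i 1 ∈ W := by
    have h1 : ∀ᶠ ε in 𝓝[>] (0 : ℝ), ε < w i :=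
      nhdsWithin_le_nhds (eventually_lt_nhds (hpos i))
    have h2 : ∀ v ∈ V, ∀ᶠ ε in 𝓝[>] (0 : ℝ), d ≤ (w - ε • Pi.single i 1) ⬝ᵥ v := by
      intro v hv
      have hexp : ∀ ε : ℝ, (w - ε • Pi.single i 1) ⬝ᵥ v = w ⬝ᵥ v - ε * v i := fun ε => by
        simp [sub_dotProduct]
      simp only [hexp]
      rcases (hwV v hv).eq_or_lt with h | h
      · have : v i = 0 := le_antisymm (hno v hv h.symm) (hV v hv i)
        simp [this, h]
      · have hlim : Tendsto (fun ε : ℝ => w ⬝ᵥ v - ε * v i) (𝓝 0) (𝓝 (w ⬝ᵥ v - 0 * v i)) :=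
          Continuous.tendsto (by fun_prop) 0
        rw [zero_mul, sub_zero] at hlim
        exact nhdsWithin_le_nhds ((hlim.eventually_const_lt h).mono fun _ => le_of_lt)
    filter_upwards [h1, (Finset.eventually_all V).mpr h2, self_mem_nhdsWithin] with ε e1 e2 e3
    rw [Set.mem_Ioi] at e3
    refine (hmem _).mpr ⟨fun j => ?_, fun j => ?_, e2⟩
    · by_cases hj : j = i
      · subst hj; simpa using e1.le
      · simpa [hj] using hw0 j
    · by_cases hj : j = i
      · subst hj
        have := hwu j
        simp only [Pi.sub_apply, Pi.smul_apply, Pi.single_eq_same, smul_eq_mul, mul_one]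
        linarith
      · simpa [hj] using hwu j
  obtain ⟨ε, hε, hε0⟩ := (hev.and self_mem_nhdsWithin).exists
  have h1 : ∑ j, w j ≤ ∑ j, (w - ε • Pi.single i 1 : Fin n → ℝ) j := hmin hε
  simp [Finset.sum_sub_distrib, ← Finset.mul_sum] at h1
  exact absurd hε0 (not_lt.mpr h1)

/-- A weight vector below prescribed orders (`I` is the set of finite ones) which attains its
minimum on `V` both off each coordinate hyperplane and on the coordinate subspace of the
indices where the prescribed orders are attained. -/
theorem exists_weight {n : ℕ} (V : Finset (Fin n → ℝ))
    (hV : ∀ v ∈ V, ∀ i, 0 ≤ v i) (hV0 : ∀ v ∈ V, v ≠ 0)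
    (haxis : ∀ i, ∃ v ∈ V, 0 < v i ∧ ∀ j, j ≠ i → v j = 0)
    (I : Set (Fin n)) (hI : I.Nonempty) (o : Fin n → ℝ) (ho : ∀ i ∈ I, 0 < o i) :
    ∃ (w : Fin n → ℝ) (d : ℝ), 0 < d ∧ (∀ i, 0 < w i) ∧ (∀ i ∈ I, w i ≤ o i) ∧
      (∀ v ∈ V, d ≤ w ⬝ᵥ v) ∧ (∀ i, ∃ v ∈ V, w ⬝ᵥ v = d ∧ 0 < v i) ∧
      ∃ v ∈ V, w ⬝ᵥ v = d ∧ ∀ i, v i ≠ 0 → i ∈ I ∧ w i = o i := by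
  classical
  let V' := V.filter fun v => ∀ i, i ∉ I → v i = 0
  have hV' : V'.Nonempty := by
    obtain ⟨i, hi⟩ := hI
    obtain ⟨v, hv, _, hvj⟩ := haxis i
    exact ⟨v, Finset.mem_filter.mpr ⟨hv, fun j hj => hvj j fun h => hj (h ▸ hi)⟩⟩
  obtain ⟨v₀, hv₀', hv₀min⟩ := V'.exists_min_image (fun v => o ⬝ᵥ v) hV'
  obtain ⟨hv₀, hv₀I⟩ := Finset.mem_filter.mp hv₀'
  have hterm : ∀ i, 0 ≤ o i * v₀ i := fun i => by
    by_cases hi : i ∈ I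
    · exact mul_nonneg (ho i hi).le (hV v₀ hv₀ i)
    · rw [hv₀I i hi, mul_zero]
  have hd : 0 < o ⬝ᵥ v₀ := by
    obtain ⟨i, hi⟩ := Function.ne_iff.mp (hV0 v₀ hv₀)
    refine Finset.sum_pos' (fun j _ => hterm j) ⟨i, Finset.mem_univ i, ?_⟩
    have hiI : i ∈ I := by_contra fun h => hi (hv₀I i h)
    exact mul_pos (ho i hiI) (lt_of_le_of_ne (hV v₀ hv₀ i) (Ne.symm hi))
  -- A large weight `M` off `I` lifts the points outside the subspace of `I` above the minimum
  -- attained at `v₀`.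
  let u : ℝ → Fin n → ℝ := fun M i => if i ∈ I then o i else M
  have huM : ∀ᶠ M in atTop, 0 ≤ M ∧ ∀ v ∈ V, o ⬝ᵥ v₀ ≤ u M ⬝ᵥ v := by
    refine (eventually_ge_atTop 0).and ((Finset.eventually_all V).mpr fun v hv => ?_)
    by_cases hvI : ∀ i, i ∉ I → v i = 0
    · refine Eventually.of_forall fun M => ?_
      refine (hv₀min v (Finset.mem_filter.mpr ⟨hv, hvI⟩)).trans (le_of_eq ?_)
      refine Finset.sum_congr rfl fun i _ => ?_
      by_cases hi : i ∈ I
      · simp [u, hi]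
      · simp [hvI i hi]
    · push Not at hvI
      obtain ⟨i, hi, hvi⟩ := hvI
      have hvi' : 0 < v i := lt_of_le_of_ne (hV v hv i) (Ne.symm hvi)
      filter_upwards [eventually_ge_atTop 0, eventually_ge_atTop (o ⬝ᵥ v₀ / v i)] with M hM0 hM
      rw [div_le_iff₀ hvi'] at hM
      refine hM.trans ?_
      have : u M i * v i ≤ u M ⬝ᵥ v := by
        refine Finset.single_le_sum (f := fun i => u M i * v i) (fun j _ => ?_)
          (Finset.mem_univ i)
        by_cases hj : j ∈ I
        · simpa [u, hj] using mul_nonneg (ho j hj).le (hV v hv j)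
        · simpa [u, hj] using mul_nonneg hM0 (hV v hv j)
      simpa [u, hi] using this
  obtain ⟨M, hM0, hM⟩ := huM.exists
  obtain ⟨w, hw0, hwu, hwV, hwi⟩ := exists_minimal_weight V hV haxis hd (u M)
    (fun i => by
      by_cases hi : i ∈ I
      · simpa [u, hi] using (ho i hi).le
      · simpa [u, hi] using hM0) hM
  have hwo : ∀ i ∈ I, w i ≤ o i := fun i hi => by simpa [u, hi] using hwu i
  have hle : ∀ i ∈ Finset.univ, w i * v₀ i ≤ o i * v₀ i := fun i _ => by
    by_cases hi : i ∈ I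
    · exact mul_le_mul_of_nonneg_right (hwo i hi) (hV v₀ hv₀ i)
    · simp [hv₀I i hi]
  -- The lower bound at `v₀` survives the lowering, so the termwise inequality `hle` is an equality;
  -- thus no weight was lowered where `v₀` is nonzero.
  have heq : w ⬝ᵥ v₀ = o ⬝ᵥ v₀ := le_antisymm (Finset.sum_le_sum hle) (hwV v₀ hv₀)
  refine ⟨w, _, hd, hw0, hwo, hwV, hwi, v₀, hv₀, heq, fun i hi => ⟨by_contra fun h =>
    hi (hv₀I i h), ?_⟩⟩
  exact mul_right_cancel₀ hi ((Finset.sum_eq_sum_iff_of_le hle).mp heq i (Finset.mem_univ i))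

end Weights

/-! ### Faces of C-diagrams and the contradiction -/

section Diagrams

variable {n : ℕ} {Γ : Set (Fin n → ℝ)}

theorem isLinearMap_dotProduct (w : Fin n → ℝ) : IsLinearMap ℝ fun x : Fin n → ℝ => w ⬝ᵥ x :=
  ⟨dotProduct_add w, fun c x => dotProduct_smul c w x⟩

/-- A C-diagram is spanned by finitely many nonzero points, including one on each axis. -/
theorem IsCDiagram.exists_finset (hΓ : IsCDiagram Γ) :
    ∃ V : Finset (Fin n → ℝ), (∀ v ∈ V, v ∈ Γ) ∧ (∀ v ∈ V, v ≠ 0) ∧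
      (∀ i, ∃ v ∈ V, 0 < v i ∧ ∀ j, j ≠ i → v j = 0) ∧
      ∀ (w : Fin n → ℝ) (d : ℝ), (∀ v ∈ V, d ≤ w ⬝ᵥ v) → ∀ x ∈ Γ, d ≤ w ⬝ᵥ x := by
  classical
  obtain ⟨S, hS⟩ := hΓ.polyhedral
  have hVΓ : ∀ s ∈ S, ∀ v ∈ s, v ∈ Γ := fun s hs v hv => by
    rw [hS]
    exact Set.mem_biUnion hs (subset_convexHull ℝ _ hv)
  have hne : ∀ v ∈ Γ, v ≠ 0 := fun v hv h0 => by
    have := (hΓ.bijOn_centralProjection.mapsTo hv).2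
    simp [h0] at this
  refine ⟨S.biUnion id, ?_, ?_, fun i => ?_, fun w d hd x hx => ?_⟩
  · intro v hv
    obtain ⟨s, hs, hvs⟩ := Finset.mem_biUnion.mp hv
    exact hVΓ s hs v hvs
  · intro v hv
    obtain ⟨s, hs, hvs⟩ := Finset.mem_biUnion.mp hv
    exact hne v (hVΓ s hs v hvs)
  · obtain ⟨y, hy, hyi⟩ := hΓ.bijOn_centralProjection.surjOn (single_mem_stdSimplex ℝ i)
    have hyj : ∀ j, j ≠ i → y j = 0 := fun j hj => by
      have h1 := congrFun hyi j
      simp only [Pi.smul_apply, Pi.single_eq_of_ne hj, smul_eq_mul, mul_eq_zero,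
        inv_eq_zero] at h1
      refine h1.resolve_left fun h0 => ?_
      have h2 : ((∑ i, y i)⁻¹ • y) i = (Pi.single i 1 : Fin n → ℝ) i := congrFun hyi i
      rw [Pi.smul_apply, h0, inv_zero, zero_smul, Pi.single_eq_same] at h2
      exact zero_ne_one h2
    -- This form vanishes on the $i$-th axis and is positive on the rest of the orthant, so a
    -- polytope of the diagram meeting the axis has a spanning point on it.
    let ℓ : Fin n → ℝ := fun j => if j = i then 0 else 1
    have hℓy : ℓ ⬝ᵥ y = 0 := Finset.sum_eq_zero fun j _ => by
      by_cases hj : j = i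
      · simp [ℓ, hj]
      · simp [hyj j hj]
    have hy' := hy
    rw [hS] at hy'
    obtain ⟨s, hs, hys⟩ := Set.mem_iUnion₂.mp hy'
    obtain ⟨v, hv, hℓv⟩ : ∃ v ∈ s, ℓ ⬝ᵥ v ≤ 0 := by
      by_contra! hall
      have : 0 < ℓ ⬝ᵥ y := convexHull_min (fun v hv => hall v hv)
        (convex_halfSpace_gt (isLinearMap_dotProduct ℓ) 0) hys
      exact this.ne' hℓy
    have hv0 := hΓ.nonneg v (hVΓ s hs v hv)
    have hnn : ∀ j ∈ Finset.univ, 0 ≤ ℓ j * v j := fun j _ => by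
      by_cases hj : j = i
      · simp [ℓ, hj]
      · simpa [ℓ, hj] using hv0 j
    have hvj : ∀ j, j ≠ i → v j = 0 := fun j hj => by
      have := (Finset.sum_eq_zero_iff_of_nonneg hnn).mp (le_antisymm hℓv (Finset.sum_nonneg hnn))
        j (Finset.mem_univ j)
      simpa [ℓ, hj] using this
    refine ⟨v, Finset.mem_biUnion.mpr ⟨s, hs, hv⟩, lt_of_le_of_ne (hv0 i) fun h => ?_, hvj⟩
    refine hne v (hVΓ s hs v hv) (funext fun j => ?_)
    by_cases hj : j = i
    · rw [hj, ← h]; rfl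
    · exact hvj j hj
  · rw [hS] at hx
    obtain ⟨s, hs, hxs⟩ := Set.mem_iUnion₂.mp hx
    exact convexHull_min (fun v hv => hd v (Finset.mem_biUnion.mpr ⟨s, hs, hv⟩))
      (convex_halfSpace_ge (isLinearMap_dotProduct w) d) hxs

theorem subset_upperRegion (Γ : Set (Fin n → ℝ)) : Γ ⊆ upperRegion Γ :=
  fun x hx => ⟨x, hx, 1, le_rfl, (one_smul ℝ x).symm⟩

theorem le_dotProduct_of_mem_upperRegion {w : Fin n → ℝ} {d : ℝ} (hd : 0 < d)
    (hw : ∀ x ∈ Γ, d ≤ w ⬝ᵥ x) {x : Fin n → ℝ} (hx : x ∈ upperRegion Γ) : d ≤ w ⬝ᵥ x := by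
  obtain ⟨y, hy, t, ht, rfl⟩ := hx
  rw [dotProduct_smul, smul_eq_mul]
  nlinarith [hw y hy]

/-- Positivity of `d` keeps the face in `Γ`: for `t > 1` the point `t • y` has weight at least `t *
d > d`. -/
theorem isFace_of_dotProduct {w : Fin n → ℝ} {d : ℝ} (hd : 0 < d) (hw : ∀ x ∈ Γ, d ≤ w ⬝ᵥ x)
    {v : Fin n → ℝ} (hv : v ∈ Γ) (hvd : w ⬝ᵥ v = d) :
    IsFace Γ {x | x ∈ upperRegion Γ ∧ w ⬝ᵥ x = d} where
  nonempty := ⟨v, subset_upperRegion Γ hv, hvd⟩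
  isExposed _ := by
    let l : (Fin n → ℝ) →L[ℝ] ℝ := LinearMap.toContinuousLinearMap
      (-(IsLinearMap.mk' _ (isLinearMap_dotProduct w)))
    have hl : ∀ x, l x = -(w ⬝ᵥ x) := fun _ => rfl
    refine ⟨l, Set.ext fun x => and_congr_right fun hx => ?_⟩
    simp only [hl, neg_le_neg_iff]
    refine ⟨fun h y hy => h ▸ le_dotProduct_of_mem_upperRegion hd hw hy, fun h => ?_⟩
    exact le_antisymm (hvd ▸ h v (subset_upperRegion Γ hv))
      (le_dotProduct_of_mem_upperRegion hd hw hx)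
  subset := by
    rintro _ ⟨⟨y, hy, t, ht, rfl⟩, h⟩
    rw [dotProduct_smul, smul_eq_mul] at h
    have h1 := hw y hy
    have : t = 1 := by
      refine le_antisymm ?_ ht
      by_contra! hlt
      nlinarith
    rwa [this, one_smul]

theorem finite_setOf_dotProduct_latticePoint_eq {w : Fin n → ℝ} (hw : ∀ i, 0 < w i) (d : ℝ) :
    {m : Fin n →₀ ℕ | w ⬝ᵥ latticePoint m = d}.Finite := by
  let B : Fin n →₀ ℕ := Finsupp.equivFunOnFinite.symm fun i => ⌊d / w i⌋₊
  refine (Set.finite_Iic B).subset fun m hm i => ?_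
  have hm : w ⬝ᵥ latticePoint m = d := hm
  refine Nat.le_floor (?_ : (m i : ℝ) ≤ d / w i)
  rw [le_div_iff₀ (hw i), ← hm, mul_comm]
  exact Finset.single_le_sum (f := fun i => w i * (m i : ℝ))
    (fun j _ => mul_nonneg (hw j).le (Nat.cast_nonneg _)) (Finset.mem_univ i)

/-- A nonconstant formal curve is not contained in the critical locus of an inner
non-degenerate series. -/
theorem IsInnerNonDegenerate.exists_map_pderiv_ne_zero {k : Type*} [Field k]
    {g : MvPowerSeries (Fin n) k} (hg : IsInnerNonDegenerate g Γ) (hΓ : IsCDiagram Γ)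
    (c : MvPowerSeries (Fin n) k →ₐ[k] PowerSeries k) (hc : ∃ i, c (MvPowerSeries.X i) ≠ 0) :
    ∃ i, c (pderiv k i g) ≠ 0 := by
  classical
  by_contra! hcrit
  obtain ⟨V, hVΓ, hV0, haxis, hVmin⟩ := hΓ.exists_finset
  let I : Set (Fin n) := {i | c (MvPowerSeries.X i) ≠ 0}
  -- For an identically zero coordinate `toNat` turns the order `⊤` into 0; such indices lie outside
  -- `I`, where `o` plays no role.
  let o : Fin n → ℕ := fun i => (c (MvPowerSeries.X i)).order.toNat
  have hcoeff : ∀ i ∈ I, PowerSeries.coeff (o i) (c (MvPowerSeries.X i)) ≠ 0 := fun i hi =>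
    PowerSeries.coeff_order hi
  have ho : ∀ i ∈ I, (0 : ℝ) < o i := fun i hi => by
    rw [Nat.cast_pos, Nat.pos_iff_ne_zero]
    intro h0
    refine hcoeff i hi ?_
    rw [h0, PowerSeries.coeff_zero_eq_constantCoeff, ← PowerSeries.X_dvd_iff]
    exact X_dvd_map_X c i
  obtain ⟨w, d, hd, hw0, hwo, hwV, hwi, v, hv, hvd, hvI⟩ :=
    exists_weight V (fun v hv => hΓ.nonneg v (hVΓ v hv)) hV0 haxis I hc (fun i => (o i : ℝ)) ho
  have hwΓ := hVmin w d hwV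
  let Q : Fin n → k := fun i =>
    if i ∈ I ∧ w i = o i then PowerSeries.coeff (o i) (c (MvPowerSeries.X i)) else 0
  have hQ : ∀ i, HasInitialCoeff (c (MvPowerSeries.X i)) (w i) (Q i) := fun i => by
    by_cases hi : i ∈ I
    · refine ⟨fun N hN => ?_, fun N hN => ?_, fun h => ?_⟩
      · refine PowerSeries.coeff_of_lt_order_toNat N ?_
        exact_mod_cast hN.trans_le (hwo i hi)
      · by_cases hwe : w i = o i
        · rw [hwe, Nat.cast_inj] at hN
          simp only [Q]
          rw [if_pos ⟨hi, hwe⟩, hN]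
        · simp only [Q]
          rw [if_neg fun h => hwe h.2]
          refine PowerSeries.coeff_of_lt_order_toNat N ?_
          have := lt_of_le_of_ne (hwo i hi) hwe
          rw [← hN] at this
          exact_mod_cast this
      · by_contra hne
        refine h (if_neg fun h' => hne ⟨o i, h'.2.symm⟩)
    · have h0 : c (MvPowerSeries.X i) = 0 := not_not.mp hi
      have hQ0 : Q i = 0 := if_neg fun h => hi h.1
      rw [h0, hQ0]
      exact ⟨fun _ _ => by simp, fun _ _ => by simp, fun h => (h rfl).elim⟩
  let Δ : Set (Fin n → ℝ) := {x | x ∈ upperRegion Γ ∧ w ⬝ᵥ x = d}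
  have hmemΔ : ∀ v ∈ V, w ⬝ᵥ v = d → v ∈ Δ := fun v hv h =>
    ⟨subset_upperRegion Γ (hVΓ v hv), h⟩
  have hΔ : IsInnerFace Γ Δ := by
    refine ⟨isFace_of_dotProduct hd hwΓ (hVΓ v hv) hvd, fun i hi => ?_⟩
    obtain ⟨v', hv', hvd', hvi'⟩ := hwi i
    exact hvi'.ne' (hi (hmemΔ v' hv' hvd'))
  -- Finiteness ensures that the `finsum` in `facePart` is the actual sum and not its default value
  -- 0.
  have hfin : {m : Fin n →₀ ℕ | latticePoint m ∈ Δ}.Finite :=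
    (finite_setOf_dotProduct_latticePoint_eq hw0 d).subset fun m hm => hm.2
  have hface : facePart g Δ =
      ∑ m ∈ hfin.toFinset, MvPolynomial.monomial m (MvPowerSeries.coeff m g) := by
    rw [facePart, ← finsum_mem_coe_finset, hfin.coe_toFinset]
  have hzero : ∀ i, MvPolynomial.aeval Q (MvPolynomial.pderiv i (facePart g Δ)) = 0 := fun i => by
    rw [hface]
    refine aeval_pderiv_initialForm_eq_zero g c hQ (fun m hm =>
      le_dotProduct_of_mem_upperRegion hd hwΓ (hg.support_subset m hm)) _ (fun m hm => ?_)
      (fun m hm hm' => ?_) i (hcrit i)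
    · exact ((Set.Finite.mem_toFinset _).mp hm).2
    · exact (Set.Finite.mem_toFinset _).mpr ⟨hg.support_subset m hm', hm⟩
  have hempty := hg.inner Δ hΔ (fun i => algebraMap k _ (Q i)) fun i => by
    have := MvPolynomial.aeval_algebraMap_apply (AlgebraicClosure k) Q
      (MvPolynomial.pderiv i (facePart g Δ))
    rw [hzero, map_zero] at this
    exact this
  refine Set.eq_empty_iff_forall_notMem.mp hempty v ⟨hmemΔ v hv hvd, fun i hi => ?_⟩
  by_contra hvi
  obtain ⟨hiI, hwi'⟩ := hvI i hvi
  rw [map_eq_zero] at hi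
  simp only [Q] at hi
  rw [if_pos ⟨hiI, hwi'⟩] at hi
  exact hcoeff i hiI hi

end Diagrams

end StableNewton

end

theorem proposition2p1 {k : Type*} [Field k] (p : ℕ) (hp : p.Prime) [CharP k p]
    {n : ℕ} (g : MvPowerSeries (Fin n) k) (Γ : Set (Fin n → ℝ))
    (hΓ : StableNewton.IsCDiagram Γ) (hg : StableNewton.IsInnerNonDegenerate g Γ) :
    ¬ StableNewton.StablyEquivalent
        ((MvPowerSeries.X 0 : MvPowerSeries (Fin 1) k) ^ p) g := by
  intro hst
  obtain ⟨c, hc, hcrit⟩ := StableNewton.exists_curve_of_stablyEquivalent p g hst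
  obtain ⟨i, hi⟩ := hg.exists_map_pderiv_ne_zero hΓ c hc
  exact hi (hcrit i)
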